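/- Consider two servers in series under synchronous sequential service (SSS). Server $1$ executes step $1$ of an update and then passes the update to server $2$, which executes step $2$ and then delivers it to a monitor; server $1$ starts a new update, fresh (of age $0$), at the instant when server $2$ completes step $2$ of the previous one, so that processing of a new update starts only, and at once, when both servers are idle. All service times are independent, and those of server $i$ are exponential with rate $\mu_i>0$, $i=1,2$. Put $\rho=\mu_1/\mu_2$. Let $q(t)\in\{1,2\}$ be the server that is busy at time $t$, and let $x_0(t),x_1(t),x_2(t)$ be the ages of the update at the monitor, at server $1$ and at server $2$: they grow at unit rate between service completions; a completion at server $1$ resets $(x_0,x_1,x_2)$ to $(x_0,x_1,x_1)$, and a completion at server $2$ resets it to $(x_2,0,x_2)$. The initial state $q(0)$ and the initial ages $x_j(0)\in\mathbb R$ are arbitrary constants. Then $x_0(t)$ is integrable for every $t\ge 0$, and the average age at the monitor is $$\Delta_{\rm SSS}(\mu_2,\rho)=\lim_{t\to\infty}\mathbb E[x_0(t)]=\frac1{\mu_2}\left(2+\frac1\rho+\frac1{\rho(1+\rho)}\right).$$ Moreover, the Markov chain on $\{1,2\}$ with transition rates $\mu_1$ from $1$ to $2$ and $\mu_2$ from $2$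 to $1$ has exactly one stationary distribution $\pi=(\pi_1,\pi_2)$, and $\Pr(q(t)=q)\to\pi_q$ as $t\to\infty$ for $q=1,2$. With $n_{q,i}$ the number of processors that execute step $i$ in state $q$ and $\bar N_i(\rho)=\sum_q\pi_q n_{q,i}$, the power-weighted processor activity $\bar N(\rho)=\rho^\alpha\bar N_1(\rho)+\bar N_2(\rho)$ satisfies, for every real $\alpha$, $$\bar N(\rho)=\frac{\rho^\alpha+\rho}{1+\rho}.$$ -/

import Mathlib

open MeasureTheory ProbabilityTheory Filter Topology

namespace SSS

/-! Two servers in series under synchronous sequential service. Servers and processing steps are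
indexed by `Fin 2`: index `0` is server 1 / step 1 and index `1` is server 2 / step 2.
Exactly one server is busy at any time, so the discrete state `q : Fin 2` of the system is the
busy server. -/

/-- What processor `p` does in state `q`: `some i` means that it executes step `i`, and `none` that
it is idle. Server `p` only ever executes step `p`. -/
def activity (q p : Fin 2) : Option (Fin 2) :=
  if p = q then some p else none

/-- `n_{q,i}`: the number of processors that execute step `i` in state `q`. -/
def numWorking (q i : Fin 2) : ℕ :=
  (Finset.univ.filter fun p : Fin 2 => activity q p = some i).card

/-- The state entered when the busy server completes its service: server 1 hands its update to the
idle server 2; when server 2 is done, both servers are idle and server 1 starts a new update. -/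
def next (q : Fin 2) : Fin 2 :=
  if q = 0 then 1 else 0

/-- The reset of the age vector `x = (x 0, x 1, x 2)` = (age at the monitor, age of the update at
server 1, age of the update at server 2) at a service completion in state `q`. A completion at
server 1 moves its update to server 2. A completion at server 2 delivers its update to the
monitor, and a fresh update (of age zero) starts service at server 1. -/
def reset (q : Fin 2) (x : Fin 3 → ℝ) : Fin 3 → ℝ :=
  if q = 0 then ![x 0, x 1, x 1] else ![x 2, 0, x 2]

section Path

/-! One sample path. `s i k` is the duration of the `k`-th service (`k = 0, 1, 2, …`) of server
`i`, `q₀` the busy server at time `0`, `x₀` the age vector at time `0`. -/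

variable (s : Fin 2 → ℕ → ℝ) (q₀ : Fin 2) (x₀ : Fin 3 → ℝ)

/-- The discrete state after `n` service completions. -/
def stateAfter (n : ℕ) : Fin 2 :=
  next^[n] q₀

/-- The duration of the `n`-th service overall (`n = 0, 1, 2, …`). The servers alternate, so it is
service number `n / 2` of the server that is busy then. -/
def duration (n : ℕ) : ℝ :=
  s (stateAfter q₀ n) (n / 2)

/-- The time of the `n`-th service completion (time `0` for `n = 0`). -/
noncomputable def completionTime (n : ℕ) : ℝ :=
  ∑ k ∈ Finset.range n, duration s q₀ k

/-- The age vector immediately after the `n`-th service completion: all ages grow at unit rate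
between completions and are reset at a completion. -/
noncomputable def agesAfter : ℕ → Fin 3 → ℝ
  | 0 => x₀
  | n + 1 => reset (stateAfter q₀ n) fun j => agesAfter n j + duration s q₀ n

/-- The number of service completions in `[0, t]`. -/
noncomputable def numCompletions (t : ℝ) : ℕ :=
  sSup {n : ℕ | completionTime s q₀ n ≤ t}

/-- The discrete state `q(t)`. -/
noncomputable def stateAt (t : ℝ) : Fin 2 :=
  stateAfter q₀ (numCompletions s q₀ t)

/-- The age vector `x(t)`. -/
noncomputable def agesAt (t : ℝ) : Fin 3 → ℝ := fun j =>
  agesAfter s q₀ x₀ (numCompletions s q₀ t) j + (t - completionTime s q₀ (numCompletions s q₀ t))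

/-- The age at the monitor at time `t`. -/
noncomputable def monitorAge (t : ℝ) : ℝ :=
  agesAt s q₀ x₀ t 0

end Path

/-- The service times `S i k` are independent, and those of server `i` are exponential with rate
`rate i`. -/
structure IsServiceTimes {Ω : Type*} [MeasurableSpace Ω] (P : Measure Ω) (rate : Fin 2 → ℝ)
    (S : Fin 2 → ℕ → Ω → ℝ) : Prop where
  hasLaw : ∀ i k, HasLaw (S i k) (expMeasure (rate i)) P
  indep : iIndepFun (fun ik : Fin 2 × ℕ => S ik.1 ik.2) P

/-- The transition rate matrix of the discrete state: state `q` is left at rate `rate q`, for the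
state `next q`. -/
def generator (rate : Fin 2 → ℝ) : Matrix (Fin 2) (Fin 2) ℝ := fun q q' =>
  if q' = q then -rate q else if q' = next q then rate q else 0

/-- `π` is a stationary distribution of the continuous-time Markov chain with rate matrix `G`. -/
def IsStationary (G : Matrix (Fin 2) (Fin 2) ℝ) (π : Fin 2 → ℝ) : Prop :=
  (∀ q, 0 ≤ π q) ∧ ∑ q, π q = 1 ∧ Matrix.vecMul π G = 0

/-- The average number of processors that execute step `i`, under the distribution `π` of the
discrete state. -/
noncomputable def meanWorking (π : Fin 2 → ℝ) (i : Fin 2) : ℝ :=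
  ∑ q, π q * (numWorking q i : ℝ)

/-- The power-weighted processor activity. -/
noncomputable def powerWeightedActivity (π : Fin 2 → ℝ) (ρ α : ℝ) : ℝ :=
  ρ ^ α * meanWorking π 0 + meanWorking π 1

end SSS

namespace SSS

/-! The pair (state, age vector) is a piecewise deterministic Markov process, so the expectation of
`f` at time `t` is `h t q₀ x₀` for a solution `h` of its backward equation. Two facts carry the
proof.

Representation (`IsBackwardSolution.integral_eq`): conditioning on the next completion replaces the
value predicted by `h` with the value of `f` at `t`, if no completion comes before `t`, or else with
a new prediction after the completion. Iterating `n` times leaves a remainder supported on the paths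
with at least `n` completions by time `t`. It vanishes in the limit, because completion times almost
surely tend to infinity and ages up to time `t` stay in a fixed box, where `h` is bounded.

Explicit solutions: for the age, `h` is affine in the ages, and its coefficients form a cascade of
relaxation equations `y' = c (g - y)` which all tend to `0`. Only the constant term survives, so the
limit forgets the initial data. For the state, `h` is a constant plus a decaying exponential. -/

/-! ### Relaxation equations. -/

/-- A relaxation equation `y' = c (g - y)` with continuous forcing has a global solution. -/
theorem exists_hasDerivAt_relaxation (c y₀ : ℝ) {g : ℝ → ℝ} (hg : Continuous g) :
    ∃ y : ℝ → ℝ, y 0 = y₀ ∧ ∀ t, HasDerivAt y (c * (g t - y t)) t := by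
  -- Variation of constants.
  refine ⟨fun t => Real.exp (-(c * t)) * (y₀ + ∫ s in (0 : ℝ)..t, c * Real.exp (c * s) * g s),
    by simp, fun t => ?_⟩
  have h1 : HasDerivAt (fun t : ℝ => Real.exp (-(c * t))) (Real.exp (-(c * t)) * (-(c * 1))) t :=
    (((hasDerivAt_id t).const_mul c).neg).exp
  have h2 : HasDerivAt (fun t : ℝ => y₀ + ∫ s in (0 : ℝ)..t, c * Real.exp (c * s) * g s)
      (c * Real.exp (c * t) * g t) t := by
    refine HasDerivAt.const_add _ ?_
    have hc : Continuous fun s => c * Real.exp (c * s) * g s := by fun_prop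
    exact intervalIntegral.integral_hasDerivAt_right (hc.intervalIntegrable _ _)
      (hc.stronglyMeasurableAtFilter _ _) hc.continuousAt
  refine (h1.mul h2).congr_deriv ?_
  have h3 : Real.exp (-(c * t)) * Real.exp (c * t) = 1 := by
    rw [← Real.exp_add]; simp
  linear_combination c * g t * h3

/-- Once `g ≤ L`, the function `exp (c t) (y t - L)` is antitone, so `y - L` lies below a decaying
exponential. Applied to `y` and to `-y`, this gives both halves of the limit. -/
theorem eventually_lt_of_relaxation {c L : ℝ} (hc : 0 < c) {g y : ℝ → ℝ}
    (hy : ∀ t, HasDerivAt y (c * (g t - y t)) t) (hg : ∀ᶠ t in atTop, g t ≤ L)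
    {M : ℝ} (hM : L < M) : ∀ᶠ t in atTop, y t < M := by
  obtain ⟨T, hT⟩ := eventually_atTop.1 hg
  have hd : ∀ t, HasDerivAt (fun t => Real.exp (c * t) * (y t - L))
      (Real.exp (c * t) * (c * 1) * (y t - L) + Real.exp (c * t) * (c * (g t - y t))) t := fun t =>
    (((hasDerivAt_id t).const_mul c).exp).mul ((hy t).sub_const L)
  have hanti : AntitoneOn (fun t => Real.exp (c * t) * (y t - L)) (Set.Ici T) := by
    refine antitoneOn_of_deriv_nonpos (convex_Ici T)
      (fun t _ => (hd t).continuousAt.continuousWithinAt)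
      (fun t _ => (hd t).differentiableAt.differentiableWithinAt) fun t ht => ?_
    rw [(hd t).deriv]
    have h1 : g t ≤ L := hT t (interior_subset ht)
    have h2 := mul_nonneg (mul_pos hc (Real.exp_pos (c * t))).le (sub_nonneg.2 h1)
    linarith
  have hlim : Tendsto (fun t => L + Real.exp (-(c * t)) * (Real.exp (c * T) * (y T - L))) atTop
      (𝓝 (L + 0 * (Real.exp (c * T) * (y T - L)))) :=
    ((Real.tendsto_exp_neg_atTop_nhds_zero.comp
      (tendsto_id.const_mul_atTop hc)).mul_const _).const_add _
  filter_upwards [hlim.eventually_lt_const (by simpa using hM), eventually_ge_atTop T] with t h1 h2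
  refine lt_of_le_of_lt ?_ h1
  have h3 := hanti (Set.mem_Ici.2 le_rfl) (Set.mem_Ici.2 h2) h2
  have h4 := mul_le_mul_of_nonneg_left h3 (Real.exp_pos (-(c * t))).le
  have h5 : Real.exp (-(c * t)) * Real.exp (c * t) = 1 := by
    rw [← Real.exp_add]; simp
  simp only [← mul_assoc, h5, one_mul] at h4
  simp only [← mul_assoc]
  linarith

/-- Solutions of `y' = c (g - y)` inherit the limit of the forcing. -/
theorem tendsto_of_relaxation {c L : ℝ} (hc : 0 < c) {g y : ℝ → ℝ}
    (hy : ∀ t, HasDerivAt y (c * (g t - y t)) t) (hg : Tendsto g atTop (𝓝 L)) :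
    Tendsto y atTop (𝓝 L) := by
  refine tendsto_order.2 ⟨fun M hM => ?_, fun M hM => ?_⟩
  · obtain ⟨K, hMK, hK⟩ := exists_between hM
    have hy' : ∀ t, HasDerivAt (fun t => -y t) (c * ((fun t => -g t) t - -y t)) t := fun t =>
      (hy t).neg.congr_deriv (by ring)
    have := eventually_lt_of_relaxation (L := -K) (M := -M) hc hy'
      ((hg.eventually_const_lt hK).mono fun t ht => by simpa using ht.le) (by simpa using hMK)
    exact this.mono fun t ht => by simpa using ht
  · obtain ⟨K, hK, hKM⟩ := exists_between hM
    exact eventually_lt_of_relaxation hc hy ((hg.eventually_lt_const hK).mono fun t ht => ht.le) hKM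

/-! ### The backward equation and its explicit solutions. -/

/-- `h` solves the backward equation of the process of states and ages with rates `rate`, with
initial condition `f`. -/
structure IsBackwardSolution (rate : Fin 2 → ℝ) (f : Fin 2 → (Fin 3 → ℝ) → ℝ)
    (h : ℝ → Fin 2 → (Fin 3 → ℝ) → ℝ) : Prop where
  continuous : ∀ q, Continuous fun p : ℝ × (Fin 3 → ℝ) => h p.1 q p.2
  initial : ∀ q x, h 0 q x = f q x
  -- The derivative is taken along the flow `x + u`, so no partial derivatives in the ages are
  -- needed.
  hasDerivAt : ∀ (τ : ℝ) (q : Fin 2) (x : Fin 3 → ℝ) (u : ℝ), HasDerivAt (fun u => h (τ - u) q fun j => x j + u)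
    (rate q * (h (τ - u) q (fun j => x j + u) -
      h (τ - u) (next q) (reset q fun j => x j + u))) u

theorem eq_zero_or_eq_one (q : Fin 2) : q = 0 ∨ q = 1 := by
  omega

/-- The probability of finding the system in state `q'`. -/
theorem exists_backwardSolution_state {rate : Fin 2 → ℝ} (hr : ∀ q, 0 < rate q) (q' : Fin 2) :
    ∃ h, IsBackwardSolution rate (fun q _ => if q = q' then 1 else 0) h ∧
      ∀ q x, Tendsto (fun t => h t q x) atTop (𝓝 (rate (next q') / (rate 0 + rate 1))) := by
  set R := rate 0 + rate 1 with hR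
  have hRpos : 0 < R := add_pos (hr 0) (hr 1)
  set p := rate (next q') / R with hp
  have hpR : p * R = rate (next q') := div_mul_cancel₀ _ hRpos.ne'
  refine ⟨fun τ q _ => p + ((if q = q' then 1 else 0) - p) * Real.exp (-(R * τ)),
    ⟨fun q => by fun_prop, fun q x => by simp, fun τ q x u => ?_⟩, fun q x => ?_⟩
  · have h1 : HasDerivAt (fun u : ℝ => Real.exp (-(R * (τ - u))))
        (Real.exp (-(R * (τ - u))) * -(R * -1)) u :=
      ((((hasDerivAt_id u).const_sub τ).const_mul R).neg).exp
    refine ((h1.const_mul ((if q = q' then 1 else 0) - p)).const_add p).congr_deriv ?_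
    fin_cases q <;> fin_cases q' <;> simp [next] at hpR ⊢ <;>
      linear_combination (-Real.exp (-(R * (τ - u)))) * hpR
  · have h1 : Tendsto (fun t : ℝ => Real.exp (-(R * t))) atTop (𝓝 0) :=
      Real.tendsto_exp_neg_atTop_nhds_zero.comp (tendsto_id.const_mul_atTop hRpos)
    simpa using (h1.const_mul ((if q = q' then 1 else 0) - p)).const_add p

/-- The mean age at the monitor. -/
theorem exists_backwardSolution_age {rate : Fin 2 → ℝ} (hr : ∀ q, 0 < rate q) :
    ∃ h, IsBackwardSolution rate (fun _ x => x 0) h ∧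
      ∀ q x, Tendsto (fun t => h t q x) atTop
        (𝓝 ((2 * rate 1 * (1 / rate 0 + 1 / rate 1) + rate 0 * (1 / rate 0 + 2 / rate 1)) /
          (rate 0 + rate 1))) := by
  have h0 := hr 0
  have h1 := hr 1
  set m := rate 0
  set n := rate 1
  have hmn : 0 < m + n := add_pos h0 h1
  have hcont : ∀ {c : ℝ} {g y : ℝ → ℝ}, (∀ t, HasDerivAt y (c * (g t - y t)) t) → Continuous y :=
    fun hy => continuous_iff_continuousAt.2 fun t => (hy t).continuousAt
  -- Affine ansatz: `a`, `l` weight `x 0`, `x 1` in state `0`, and `e`, `k` weight `x 0`, `x 2` in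
  -- state `1`; the remaining age is overwritten before it can matter. Each weight relaxes to the
  -- weight of the entry to which the completion moves its age; `e` has forcing `0` because that
  -- completion discards `x 0`.
  obtain ⟨e, e0, he⟩ := exists_hasDerivAt_relaxation n 1 (g := fun _ => 0) continuous_const
  obtain ⟨a, a0, ha⟩ := exists_hasDerivAt_relaxation m 1 (g := e) (hcont he)
  obtain ⟨k, k0, hk⟩ := exists_hasDerivAt_relaxation n 0 (g := a) (hcont ha)
  obtain ⟨l, l0, hl⟩ := exists_hasDerivAt_relaxation m 0 (g := k) (hcont hk)
  have ce := hcont he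
  have ca := hcont ha
  have ck := hcont hk
  have cl := hcont hl
  -- The constant terms `b₀`, `b₁` of the two states are coupled. Their difference `d = b₁ - b₀`
  -- relaxes at rate `m + n`, while `w = n b₀ + m b₁` has forcing only.
  obtain ⟨d, d0, hd⟩ := exists_hasDerivAt_relaxation (m + n) 0
    (g := fun t => (e t + k t - a t - l t) / (m + n)) (by fun_prop)
  have cd := hcont hd
  have te : Tendsto e atTop (𝓝 0) := tendsto_of_relaxation h1 he tendsto_const_nhds
  have ta := tendsto_of_relaxation h0 ha te
  have tk := tendsto_of_relaxation h1 hk ta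
  have tl := tendsto_of_relaxation h0 hl tk
  have td : Tendsto d atTop (𝓝 0) := by
    refine tendsto_of_relaxation hmn hd ?_
    simpa using (((te.add tk).sub ta).sub tl).div_const (m + n)
  set C := 2 * n * (1 / m + 1 / n) + m * (1 / m + 2 / n) with hC
  -- The cascade yields antiderivatives: `-e/n` for `e`, then `-e/n - a/m` for `a`, and so on. `C`
  -- makes `w 0 = 0`, hence is the total integral of the forcing.
  let w : ℝ → ℝ := fun t => C + n * ((-e t / n - a t / m) + (-e t / n - a t / m - k t / n - l t / m))
    + m * (-e t / n + (-e t / n - a t / m - k t / n))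
  have hw : ∀ t, HasDerivAt w (n * (a t + l t) + m * (e t + k t)) t := fun t => by
    have E := ((he t).neg.div_const n)
    have A := E.sub ((ha t).div_const m)
    have K := A.sub ((hk t).div_const n)
    have Lm := K.sub ((hl t).div_const m)
    refine ((((A.add Lm).const_mul n).const_add C).add ((E.add K).const_mul m)).congr_deriv ?_
    field_simp
    ring
  have cw : Continuous w := continuous_iff_continuousAt.2 fun t => (hw t).continuousAt
  have w0 : w 0 = 0 := by
    simp only [w, e0, a0, k0, l0, hC]
    field_simp
    ring
  have tw : Tendsto w atTop (𝓝 C) := by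
    have E := (te.neg.div_const n)
    have A := E.sub (ta.div_const m)
    have K := A.sub (tk.div_const n)
    have Lm := K.sub (tl.div_const m)
    simpa using (((A.add Lm).const_mul n).const_add C).add ((E.add K).const_mul m)
  refine ⟨fun τ q x => if q = 0 then a τ * x 0 + l τ * x 1 + (w τ - m * d τ) / (m + n)
    else e τ * x 0 + k τ * x 2 + (w τ + n * d τ) / (m + n), ⟨fun q => ?_, fun q x => ?_,
    fun τ q x u => ?_⟩, fun q x => ?_⟩
  · obtain rfl | rfl := eq_zero_or_eq_one q
    · simp only [if_true]; fun_prop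
    · simp only [one_ne_zero, if_false]; fun_prop
  · obtain rfl | rfl := eq_zero_or_eq_one q <;> simp [e0, a0, k0, l0, d0, w0]
  · have comp : ∀ {y : ℝ → ℝ} {y' : ℝ}, HasDerivAt y y' (τ - u) →
        HasDerivAt (fun u => y (τ - u)) (-y') u := fun hy => by
      simpa using hy.comp_const_sub τ u
    have X : ∀ j, HasDerivAt (fun u => x j + u) 1 u := fun j => (hasDerivAt_id u).const_add _
    have E := comp (he (τ - u))
    have A := comp (ha (τ - u))
    have K := comp (hk (τ - u))
    have Lm := comp (hl (τ - u))
    have D := comp (hd (τ - u))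
    have W := comp (hw (τ - u))
    obtain rfl | rfl := eq_zero_or_eq_one q
    · simp only [if_true]
      refine (((A.mul (X 0)).add (Lm.mul (X 1))).add
        ((W.sub (D.const_mul m)).div_const (m + n))).congr_deriv ?_
      simp [next, reset]
      field_simp
      ring
    · simp only [one_ne_zero, if_false]
      refine (((E.mul (X 0)).add (K.mul (X 2))).add
        ((W.add (D.const_mul n)).div_const (m + n))).congr_deriv ?_
      simp [next, reset]
      field_simp
      ring
  · obtain rfl | rfl := eq_zero_or_eq_one q
    · simpa using ((ta.mul_const (x 0)).add (tl.mul_const (x 1))).add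
        ((tw.sub (td.const_mul m)).div_const (m + n))
    · simpa using ((te.mul_const (x 0)).add (tk.mul_const (x 2))).add
        ((tw.add (td.const_mul n)).div_const (m + n))

/-! ### Exponential laws and the first completion. -/

theorem expMeasure_Iic {r : ℝ} (hr : 0 < r) (x : ℝ) :
    (expMeasure r).real (Set.Iic x) = if 0 ≤ x then 1 - Real.exp (-(r * x)) else 0 := by
  have := isProbabilityMeasure_expMeasure hr
  rw [← cdf_eq_real, cdf_expMeasure_eq hr]

theorem expMeasure_Ioi {r : ℝ} (hr : 0 < r) {x : ℝ} (hx : 0 ≤ x) :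
    (expMeasure r).real (Set.Ioi x) = Real.exp (-(r * x)) := by
  have := isProbabilityMeasure_expMeasure hr
  rw [← Set.compl_Iic, probReal_compl_eq_one_sub measurableSet_Iic, expMeasure_Iic hr, if_pos hx]
  ring

theorem ae_expMeasure_pos {r : ℝ} (hr : 0 < r) : ∀ᵐ u ∂expMeasure r, 0 < u := by
  have := isProbabilityMeasure_expMeasure hr
  have h := expMeasure_Iic hr 0
  simp only [le_refl, if_true, mul_zero, neg_zero, Real.exp_zero, sub_self] at h
  rw [measureReal_eq_zero_iff] at h
  simpa [ae_iff, Set.Iic] using h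

/-- Integration against an exponential law of a function that is constant beyond `τ`. -/
theorem integral_expMeasure_ite {r : ℝ} (hr : 0 < r) {τ : ℝ} (hτ : 0 ≤ τ) (c : ℝ) {φ : ℝ → ℝ}
    (hφ : Continuous φ) :
    ∫ u, (if τ < u then c else φ u) ∂expMeasure r =
      c * Real.exp (-(r * τ)) + ∫ u in (0 : ℝ)..τ, r * Real.exp (-(r * u)) * φ u := by
  have := isProbabilityMeasure_expMeasure hr
  -- `φ` may be unbounded at `-∞`, but the law charges only positive numbers, which leaves a compact
  -- interval.
  have hφi : IntegrableOn φ (Set.Iic τ) (expMeasure r) := by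
    have h1 : IntegrableOn φ (Set.Icc 0 τ) (expMeasure r) := hφ.continuousOn.integrableOn_Icc
    refine h1.mono_set_ae ?_
    filter_upwards [ae_expMeasure_pos hr] with u hu hu'
    exact ⟨hu.le, hu'⟩
  have hint : Integrable (fun u => if τ < u then c else φ u) (expMeasure r) := by
    have := Integrable.piecewise (s := Set.Ioi τ) (f := fun _ => c) (g := φ) (μ := expMeasure r)
      measurableSet_Ioi (integrable_const c).integrableOn (by simpa using hφi)
    refine this.congr (Eventually.of_forall fun u => ?_)
    simp [Set.piecewise]
  rw [← integral_add_compl measurableSet_Ioi hint (s := Set.Ioi τ), Set.compl_Ioi,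
    setIntegral_congr_fun (g := fun _ => c) measurableSet_Ioi
      (fun u hu => by simp [Set.mem_Ioi.1 hu]),
    setIntegral_congr_fun (s := Set.Iic τ) (g := φ) measurableSet_Iic
      (fun u hu => by simp [not_lt.2 (Set.mem_Iic.1 hu)]),
    setIntegral_const, expMeasure_Ioi hr hτ, smul_eq_mul, mul_comm]
  congr 1
  have h2 : ∫ u in Set.Iic τ, φ u ∂expMeasure r = ∫ u in Set.Ioc 0 τ, φ u ∂expMeasure r := by
    refine setIntegral_congr_set ?_
    filter_upwards [ae_expMeasure_pos hr] with u hu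
    exact propext ⟨fun h => ⟨hu, h⟩, fun h => h.2⟩
  have h3 : expMeasure r = volume.withDensity (exponentialPDF r) := rfl
  rw [h2, intervalIntegral.integral_of_le hτ, h3,
    setIntegral_withDensity_eq_setIntegral_toReal_smul _ _ _ measurableSet_Ioc]
  · refine setIntegral_congr_fun measurableSet_Ioc fun u hu => ?_
    simp only [exponentialPDF_of_nonneg hu.1.le, smul_eq_mul]
    rw [ENNReal.toReal_ofReal (mul_pos hr (Real.exp_pos _)).le]
  · exact (measurable_exponentialPDFReal r).ennreal_ofReal
  · exact Eventually.of_forall fun u => ENNReal.ofReal_lt_top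

theorem continuous_reset (q : Fin 2) : Continuous (reset q) := by
  obtain rfl | rfl := eq_zero_or_eq_one q <;>
  · refine continuous_pi fun j => ?_
    fin_cases j <;> simp [reset] <;> fun_prop

/-- Conditioning on the first completion: either it occurs after `τ`, or the process restarts. -/
theorem IsBackwardSolution.integral_first_completion {rate : Fin 2 → ℝ} (hr : ∀ q, 0 < rate q)
    {f : Fin 2 → (Fin 3 → ℝ) → ℝ} {h : ℝ → Fin 2 → (Fin 3 → ℝ) → ℝ}
    (hh : IsBackwardSolution rate f h) {τ : ℝ} (hτ : 0 ≤ τ) (q : Fin 2) (x : Fin 3 → ℝ) :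
    ∫ u, (if τ < u then f q (fun j => x j + τ)
      else h (τ - u) (next q) (reset q fun j => x j + u)) ∂expMeasure (rate q) = h τ q x := by
  have hc : ∀ q' (ψ : ℝ → Fin 3 → ℝ), Continuous ψ → Continuous fun u => h (τ - u) q' (ψ u) :=
    fun q' ψ hψ => (hh.continuous q').comp ((continuous_const.sub continuous_id).prodMk hψ)
  have hψ : Continuous fun (u : ℝ) (j : Fin 3) => x j + u := by fun_prop
  have hc1 := hc (next q) _ ((continuous_reset q).comp hψ)
  simp only [Function.comp_def] at hc1
  rw [integral_expMeasure_ite (hr q) hτ _ hc1]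
  -- The survival factor cancels the loss term of the backward equation, which leaves the density
  -- times the value after the jump. The boundary term at `u = τ` cancels the no-completion term;
  -- the one at `u = 0` is the claim.
  have hd : ∀ u, HasDerivAt (fun u => -(Real.exp (-(rate q * u)) * h (τ - u) q fun j => x j + u))
      (rate q * Real.exp (-(rate q * u)) *
        h (τ - u) (next q) (reset q fun j => x j + u)) u := fun u => by
    have h1 : HasDerivAt (fun u : ℝ => Real.exp (-(rate q * u)))
        (Real.exp (-(rate q * u)) * -(rate q * 1)) u :=
      (((hasDerivAt_id u).const_mul (rate q)).neg).exp
    exact (h1.mul (hh.hasDerivAt τ q x u)).neg.congr_deriv (by ring)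
  rw [intervalIntegral.integral_eq_sub_of_hasDerivAt (fun u _ => hd u)
    (Continuous.intervalIntegrable ((by fun_prop : Continuous fun u : ℝ =>
      rate q * Real.exp (-(rate q * u))).mul hc1) _ _)]
  simp [hh.initial]
  ring

/-! ### Regular sample paths. -/

theorem stateAfter_succ (q₀ : Fin 2) (n : ℕ) :
    stateAfter q₀ (n + 1) = next (stateAfter q₀ n) :=
  Function.iterate_succ_apply' _ _ _

theorem completionTime_succ (s : Fin 2 → ℕ → ℝ) (q₀ : Fin 2) (n : ℕ) :
    completionTime s q₀ (n + 1) = completionTime s q₀ n + duration s q₀ n :=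
  Finset.sum_range_succ _ _

/-- The state gives the parity of `n`, which together with `n / 2` determines `n`. Hence no service
time is used twice, and the durations inherit independence. -/
theorem injective_stateAfter_div_two (q₀ : Fin 2) :
    Function.Injective fun n : ℕ => (stateAfter q₀ n, n / 2) := by
  have hinv : Function.Involutive next := fun q => by revert q; decide
  have hne : next q₀ ≠ q₀ := by revert q₀; decide
  intro n m hnm
  obtain ⟨h1, h2⟩ := Prod.mk.inj hnm
  simp only [stateAfter] at h1
  rcases Nat.even_or_odd n with hn | hn <;> rcases Nat.even_or_odd m with hm | hm
  · obtain ⟨a, rfl⟩ := hn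
    obtain ⟨b, rfl⟩ := hm
    omega
  · rw [hinv.iterate_even hn, hinv.iterate_odd hm] at h1
    exact absurd h1.symm hne
  · rw [hinv.iterate_odd hn, hinv.iterate_even hm] at h1
    exact absurd h1 hne
  · obtain ⟨a, rfl⟩ := hn
    obtain ⟨b, rfl⟩ := hm
    omega

/-- The service times of a path are positive and have an infinite sum. -/
structure IsRegular (s : Fin 2 → ℕ → ℝ) (q₀ : Fin 2) : Prop where
  pos : ∀ n, 0 < duration s q₀ n
  unbounded : ∀ t, ∃ n, t < completionTime s q₀ n

namespace IsRegular

variable {s : Fin 2 → ℕ → ℝ} {q₀ : Fin 2}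

theorem strictMono (hs : IsRegular s q₀) : StrictMono (completionTime s q₀) :=
  strictMono_nat_of_lt_succ fun n => by
    rw [completionTime_succ]
    exact lt_add_of_pos_right _ (hs.pos n)

theorem completionTime_nonneg (hs : IsRegular s q₀) (n : ℕ) : 0 ≤ completionTime s q₀ n := by
  simpa [completionTime] using hs.strictMono.monotone n.zero_le

theorem numCompletions_spec (hs : IsRegular s q₀) {t : ℝ} (ht : 0 ≤ t) :
    completionTime s q₀ (numCompletions s q₀ t) ≤ t ∧
      t < completionTime s q₀ (numCompletions s q₀ t + 1) := by
  obtain ⟨M, hM⟩ := hs.unbounded t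
  -- On `ℕ`, `sSup` is attained only for a bounded nonempty set; for an unbounded one it is the
  -- default `0`.
  have hb : BddAbove {n : ℕ | completionTime s q₀ n ≤ t} :=
    ⟨M, fun n hn => (hs.strictMono.lt_iff_lt.1 (lt_of_le_of_lt hn hM)).le⟩
  have hne : {n : ℕ | completionTime s q₀ n ≤ t}.Nonempty := ⟨0, by simpa [completionTime]⟩
  refine ⟨Nat.sSup_mem hne hb, lt_of_not_ge fun h => ?_⟩
  exact absurd (le_csSup hb h) (Nat.not_succ_le_self _)

theorem le_iff_le_numCompletions (hs : IsRegular s q₀) {t : ℝ} (ht : 0 ≤ t) (n : ℕ) :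
    completionTime s q₀ n ≤ t ↔ n ≤ numCompletions s q₀ t := by
  have h := hs.numCompletions_spec ht
  refine ⟨fun hn => Nat.lt_succ_iff.1 (hs.strictMono.lt_iff_lt.1 (lt_of_le_of_lt hn h.2)),
    fun hn => (hs.strictMono.monotone hn).trans h.1⟩

/-- A reset only copies entries or inserts `0`, so the bound grows with elapsed time alone. -/
theorem abs_agesAfter_le (hs : IsRegular s q₀) {x₀ : Fin 3 → ℝ} {C : ℝ} (hC : 0 ≤ C)
    (hx : ∀ j, |x₀ j| ≤ C) (n : ℕ) : ∀ j, |agesAfter s q₀ x₀ n j| ≤ C + completionTime s q₀ n := by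
  induction n with
  | zero => simpa [completionTime, agesAfter] using hx
  | succ n ih =>
    have hT := hs.completionTime_nonneg (n + 1)
    rw [completionTime_succ] at hT ⊢
    have h1 : ∀ j, |agesAfter s q₀ x₀ n j + duration s q₀ n| ≤
        C + (completionTime s q₀ n + duration s q₀ n) := fun j => by
      have h2 := abs_add_le (agesAfter s q₀ x₀ n j) (duration s q₀ n)
      rw [abs_of_pos (hs.pos n)] at h2
      linarith [ih j]
    intro j
    simp only [agesAfter, reset]
    split_ifs <;> fin_cases j <;> (simp [h1]; try positivity)

end IsRegular

/-! ### Measurability, independence and almost sure regularity. -/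

section Measurability

variable {Ω : Type*} {mΩ : MeasurableSpace Ω} {S : Fin 2 → ℕ → Ω → ℝ} {q₀ : Fin 2} {n : ℕ}

/-- The σ-algebra on `Ω` is left free and only durations before `n` are assumed measurable, so that
this applies to the σ-algebra generated by the first `n` durations. -/
theorem measurable_completionTime
    (hS : ∀ k < n, Measurable fun ω => duration (fun i k => S i k ω) q₀ k) :
    Measurable fun ω => completionTime (fun i k => S i k ω) q₀ n :=
  Finset.measurable_fun_sum _ fun k hk => hS k (Finset.mem_range.1 hk)

theorem measurable_agesAfter (x₀ : Fin 3 → ℝ)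
    (hS : ∀ k < n, Measurable fun ω => duration (fun i k => S i k ω) q₀ k) :
    Measurable fun ω => agesAfter (fun i k => S i k ω) q₀ x₀ n := by
  induction n with
  | zero => exact measurable_const
  | succ n ih =>
    refine (continuous_reset _).measurable.comp (measurable_pi_lambda _ fun j => ?_)
    exact ((measurable_pi_apply j).comp (ih fun k hk => hS k (hk.trans n.lt_succ_self))).add
      (hS n n.lt_succ_self)

end Measurability

section Probability

variable {Ω : Type*} [MeasurableSpace Ω] {P : Measure Ω} {rate : Fin 2 → ℝ}
  {S : Fin 2 → ℕ → Ω → ℝ}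

theorem IsServiceTimes.iIndepFun_duration (hS : IsServiceTimes P rate S) (q₀ : Fin 2) :
    iIndepFun (fun n ω => duration (fun i k => S i k ω) q₀ n) P :=
  hS.indep.precomp (injective_stateAfter_div_two q₀)

/-- By the second Borel–Cantelli lemma infinitely many durations exceed `1`, so their sum diverges.
-/
theorem IsServiceTimes.ae_isRegular (hS : IsServiceTimes P rate S) (hr : ∀ q, 0 < rate q)
    (hm : ∀ i k, Measurable (S i k)) (q₀ : Fin 2) :
    ∀ᵐ ω ∂P, IsRegular (fun i k => S i k ω) q₀ := by
  have hind := hS.iIndepFun_duration q₀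
  have := hind.isProbabilityMeasure
  have hpos : ∀ᵐ ω ∂P, ∀ n, 0 < duration (fun i k => S i k ω) q₀ n := by
    refine ae_all_iff.2 fun n => ?_
    have h := hS.hasLaw (stateAfter q₀ n) (n / 2)
    refine ae_of_ae_map h.aemeasurable ?_
    rw [h.map_eq]
    exact ae_expMeasure_pos (hr _)
  have hlim : P (limsup (fun n => {ω | 1 < duration (fun i k => S i k ω) q₀ n}) atTop) = 1 := by
    refine measure_limsup_eq_one (fun n => measurableSet_lt measurable_const (hm _ _)) ?_ ?_
    · refine (iIndepSet_iff_meas_biInter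
        (fun n => measurableSet_lt measurable_const (hm _ _))).2 fun s => ?_
      exact hind.meas_biInter fun i _ => ⟨Set.Ioi 1, measurableSet_Ioi, rfl⟩
    · have hle : ∀ n, ENNReal.ofReal (Real.exp (-(rate 0 + rate 1))) ≤
          P {ω | 1 < duration (fun i k => S i k ω) q₀ n} := fun n => by
        have := isProbabilityMeasure_expMeasure (hr (stateAfter q₀ n))
        have h := (hS.hasLaw (stateAfter q₀ n) (n / 2)).measure_eq (p := fun u => 1 < u)
          measurableSet_Ioi
        refine le_of_le_of_eq ?_ h.symm
        rw [← ofReal_measureReal]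
        refine ENNReal.ofReal_le_ofReal ?_
        refine le_of_le_of_eq ?_ (expMeasure_Ioi (hr (stateAfter q₀ n)) zero_le_one).symm
        have h0 := hr 0
        have h1 := hr 1
        rw [Real.exp_le_exp]
        obtain h | h := eq_zero_or_eq_one (stateAfter q₀ n) <;> rw [h] <;> linarith
      refine top_unique (le_trans (ENNReal.tsum_const_eq_top_of_ne_zero ?_).ge
        (ENNReal.tsum_le_tsum hle))
      simpa using Real.exp_pos _
  have hlim' := (mem_ae_iff_prob_eq_one (MeasurableSet.measurableSet_limsup
    fun n => measurableSet_lt measurable_const (hm _ _))).2 hlim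
  filter_upwards [hpos, hlim'] with ω hω hω'
  refine ⟨hω, fun t => ?_⟩
  have hfreq := mem_limsup_iff_frequently_mem.1 hω'
  have hmono : Monotone (completionTime (fun i k => S i k ω) q₀) :=
    monotone_nat_of_le_succ fun n => by
      rw [completionTime_succ]
      exact le_add_of_nonneg_right (hω n).le
  have hnat : ∀ m : ℕ, ∃ n, (m : ℝ) ≤ completionTime (fun i k => S i k ω) q₀ n := fun m => by
    induction m with
    | zero => exact ⟨0, by simp [completionTime]⟩
    | succ m ih =>
      obtain ⟨n, hn⟩ := ih
      obtain ⟨k, hk, hk'⟩ := frequently_atTop.1 hfreq n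
      refine ⟨k + 1, ?_⟩
      have h1 : 1 < duration (fun i k => S i k ω) q₀ k := hk'
      have h2 := hmono hk
      rw [completionTime_succ]
      push_cast
      linarith
  obtain ⟨m, hm'⟩ := exists_nat_gt t
  obtain ⟨n, hn⟩ := hnat m
  exact ⟨n, hm'.trans_le hn⟩

/-- The history up to completion `n` is a function of the durations with index below `n`. -/
theorem IsServiceTimes.indepFun_completion (hS : IsServiceTimes P rate S)
    (hm : ∀ i k, Measurable (S i k)) (q₀ : Fin 2) (x₀ : Fin 3 → ℝ) (n : ℕ) :
    IndepFun (fun ω => (completionTime (fun i k => S i k ω) q₀ n,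
      agesAfter (fun i k => S i k ω) q₀ x₀ n))
      (fun ω => duration (fun i k => S i k ω) q₀ n) P := by
  have h := (hS.iIndepFun_duration q₀).indepFun_finset (Finset.range n) {n}
    (by simp) fun k => hm _ _
  have hψ : Measurable fun v : ({n} : Finset ℕ) → ℝ => v ⟨n, Finset.mem_singleton_self n⟩ :=
    measurable_pi_apply _
  have h' := h.comp measurable_id hψ
  rw [IndepFun_iff_Indep] at h' ⊢
  refine indep_of_indep_of_le_left h' ?_
  refine Measurable.comap_le ?_
  have hd : ∀ k < n, Measurable[MeasurableSpace.comap
      (id ∘ fun ω (i : Finset.range n) => duration (fun i k => S i k ω) q₀ i) inferInstance]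
      fun ω => duration (fun i k => S i k ω) q₀ k := fun k hk =>
    (measurable_pi_apply (⟨k, Finset.mem_range.2 hk⟩ : Finset.range n)).comp
      (comap_measurable (id ∘ fun ω (i : Finset.range n) => duration (fun i k => S i k ω) q₀ i))
  exact Measurable.prodMk (measurable_completionTime hd) (measurable_agesAfter x₀ hd)

end Probability

/-! ### Bounds and the decomposition of a trajectory by number of completions. -/

/-- Compactness of a time interval times a box of ages; this supplies the dominating constant for
the limits. -/
theorem IsBackwardSolution.exists_bound {rate : Fin 2 → ℝ} {f : Fin 2 → (Fin 3 → ℝ) → ℝ}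
    {h : ℝ → Fin 2 → (Fin 3 → ℝ) → ℝ} (hh : IsBackwardSolution rate f h) (t C : ℝ) :
    ∃ B, ∀ q τ x, 0 ≤ τ → τ ≤ t → (∀ j, |x j| ≤ C) → |h τ q x| ≤ B := by
  have hc : IsCompact (Set.Icc (0 : ℝ) t ×ˢ (Set.pi Set.univ fun _ : Fin 3 => Set.Icc (-C) C)) :=
    isCompact_Icc.prod (isCompact_univ_pi fun _ => isCompact_Icc)
  choose B hB using fun q => hc.exists_bound_of_continuousOn (hh.continuous q).continuousOn
  refine ⟨max (B 0) (B 1), fun q τ x h0 h1 hx => ?_⟩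
  have := hB q (τ, x) ⟨⟨h0, h1⟩, fun j _ => abs_le.1 (hx j)⟩
  refine this.trans ?_
  obtain rfl | rfl := eq_zero_or_eq_one q
  exacts [le_max_left _ _, le_max_right _ _]

section Trajectory

variable (f : Fin 2 → (Fin 3 → ℝ) → ℝ) (h : ℝ → Fin 2 → (Fin 3 → ℝ) → ℝ)
  (s : Fin 2 → ℕ → ℝ) (q₀ : Fin 2) (x₀ : Fin 3 → ℝ) (t : ℝ) (n : ℕ)

open Classical in
/-- The value of `f` at time `t` if exactly `n` services are completed then, and `0` otherwise. -/
noncomputable def currentValue : ℝ :=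
  if completionTime s q₀ n ≤ t ∧ t < completionTime s q₀ (n + 1) then
    f (stateAfter q₀ n) fun j => agesAfter s q₀ x₀ n j + (t - completionTime s q₀ n)
  else 0

open Classical in
/-- The value predicted by `h` at the `n`-th completion if it occurs before `t`, and `0`
otherwise. -/
noncomputable def pendingValue : ℝ :=
  if completionTime s q₀ n ≤ t then
    h (t - completionTime s q₀ n) (stateAfter q₀ n) (agesAfter s q₀ x₀ n)
  else 0

variable {f h s q₀ x₀ t n}

theorem IsRegular.currentValue_eq (hs : IsRegular s q₀) (ht : 0 ≤ t) :
    currentValue f s q₀ x₀ t n =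
      if n = numCompletions s q₀ t then f (stateAt s q₀ t) (agesAt s q₀ x₀ t) else 0 := by
  have hiff : (completionTime s q₀ n ≤ t ∧ t < completionTime s q₀ (n + 1)) ↔
      n = numCompletions s q₀ t := by
    rw [← not_le, hs.le_iff_le_numCompletions ht, hs.le_iff_le_numCompletions ht]
    omega
  unfold currentValue
  by_cases hn : n = numCompletions s q₀ t
  · rw [if_pos (hiff.2 hn), if_pos hn, hn]
    rfl
  · rw [if_neg (mt hiff.1 hn), if_neg hn]

/-- At most one summand is nonzero, so the partial sums obey the same bound as `f` and are
eventually constant. -/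
theorem IsRegular.sum_currentValue_eq (hs : IsRegular s q₀) (ht : 0 ≤ t) :
    ∑ k ∈ Finset.range n, currentValue f s q₀ x₀ t k =
      if numCompletions s q₀ t < n then f (stateAt s q₀ t) (agesAt s q₀ x₀ t) else 0 := by
  simp only [hs.currentValue_eq ht, Finset.sum_ite_eq', Finset.mem_range]

theorem IsRegular.abs_agesAt_le (hs : IsRegular s q₀) (ht : 0 ≤ t) {C : ℝ} (hC : 0 ≤ C)
    (hx : ∀ j, |x₀ j| ≤ C) (j : Fin 3) : |agesAt s q₀ x₀ t j| ≤ C + t := by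
  have h1 := hs.abs_agesAfter_le hC hx (numCompletions s q₀ t) j
  have h2 := (hs.numCompletions_spec ht).1
  have h3 := abs_add_le (agesAfter s q₀ x₀ (numCompletions s q₀ t) j)
    (t - completionTime s q₀ (numCompletions s q₀ t))
  rw [abs_of_nonneg (sub_nonneg.2 h2)] at h3
  unfold agesAt
  linarith

theorem IsRegular.abs_pendingValue_le (hs : IsRegular s q₀) {B C : ℝ} (hB₀ : 0 ≤ B)
    (hC : 0 ≤ C) (hx : ∀ j, |x₀ j| ≤ C)
    (hB : ∀ q τ x, 0 ≤ τ → τ ≤ t → (∀ j, |x j| ≤ C + t) → |h τ q x| ≤ B) :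
    |pendingValue h s q₀ x₀ t n| ≤ B := by
  unfold pendingValue
  split_ifs with hn
  · have h0 := hs.completionTime_nonneg n
    exact hB _ _ _ (sub_nonneg.2 hn) (by linarith) fun j =>
      (hs.abs_agesAfter_le hC hx n j).trans (by linarith)
  · simpa

end Trajectory

/-! ### Expectations through the backward equation. -/

section Expectation

variable {Ω : Type*} [MeasurableSpace Ω] {P : Measure Ω}
  {rate : Fin 2 → ℝ} {S : Fin 2 → ℕ → Ω → ℝ}
  {f : Fin 2 → (Fin 3 → ℝ) → ℝ} {h : ℝ → Fin 2 → (Fin 3 → ℝ) → ℝ}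

theorem IsBackwardSolution.continuous_initial (hh : IsBackwardSolution rate f h) (q : Fin 2) :
    Continuous (f q) :=
  ((hh.continuous q).comp (continuous_const.prodMk continuous_id)).congr fun x => hh.initial q x

theorem IsBackwardSolution.measurable_pendingValue (hh : IsBackwardSolution rate f h)
    (hm : ∀ i k, Measurable (S i k)) (q₀ : Fin 2) (x₀ : Fin 3 → ℝ) (t : ℝ) (n : ℕ) :
    Measurable fun ω => pendingValue h (fun i k => S i k ω) q₀ x₀ t n := by
  have hT := measurable_completionTime (S := S) (q₀ := q₀) (n := n) fun k _ => hm _ _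
  have hX := measurable_agesAfter (S := S) (q₀ := q₀) (n := n) x₀ fun k _ => hm _ _
  exact Measurable.ite (measurableSet_le hT measurable_const)
    ((hh.continuous _).measurable.comp ((measurable_const.sub hT).prodMk hX)) measurable_const

theorem IsBackwardSolution.measurable_currentValue (hh : IsBackwardSolution rate f h)
    (hm : ∀ i k, Measurable (S i k)) (q₀ : Fin 2) (x₀ : Fin 3 → ℝ) (t : ℝ) (n : ℕ) :
    Measurable fun ω => currentValue f (fun i k => S i k ω) q₀ x₀ t n := by
  have hT := fun n => measurable_completionTime (S := S) (q₀ := q₀) (n := n) fun k _ => hm _ _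
  have hX := measurable_agesAfter (S := S) (q₀ := q₀) (n := n) x₀ fun k _ => hm _ _
  refine Measurable.ite ((measurableSet_le (hT n) measurable_const).inter
    (measurableSet_lt measurable_const (hT (n + 1))))
    ((hh.continuous_initial _).measurable.comp (measurable_pi_lambda _ fun j => ?_))
    measurable_const
  exact ((measurable_pi_apply j).comp hX).add (measurable_const.sub (hT n))

open Classical in
/-- The expected pending value splits according to whether the next completion occurs before `t`. -/
theorem IsBackwardSolution.integral_pendingValue [IsProbabilityMeasure P]
    (hh : IsBackwardSolution rate f h)
    (hr : ∀ q, 0 < rate q) (hS : IsServiceTimes P rate S) (hm : ∀ i k, Measurable (S i k))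
    (q₀ : Fin 2) (x₀ : Fin 3 → ℝ) (t : ℝ) (n : ℕ)
    (hi : Integrable (fun ω => currentValue f (fun i k => S i k ω) q₀ x₀ t n +
      pendingValue h (fun i k => S i k ω) q₀ x₀ t (n + 1)) P) :
    ∫ ω, pendingValue h (fun i k => S i k ω) q₀ x₀ t n ∂P =
      ∫ ω, (currentValue f (fun i k => S i k ω) q₀ x₀ t n +
        pendingValue h (fun i k => S i k ω) q₀ x₀ t (n + 1)) ∂P := by
  set q := stateAfter q₀ n with hq
  let Z : Ω → ℝ × (Fin 3 → ℝ) := fun ω =>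
    (completionTime (fun i k => S i k ω) q₀ n, agesAfter (fun i k => S i k ω) q₀ x₀ n)
  let D : Ω → ℝ := fun ω => duration (fun i k => S i k ω) q₀ n
  -- The right-hand integrand as a function of the history `Z` and the next duration `D`. These are
  -- independent, so Fubini allows integrating over `D` first.
  let K : (ℝ × (Fin 3 → ℝ)) × ℝ → ℝ := fun p => if p.1.1 ≤ t then
    (if t - p.1.1 < p.2 then f q (fun j => p.1.2 j + (t - p.1.1))
      else h (t - p.1.1 - p.2) (next q) (reset q fun j => p.1.2 j + p.2)) else 0
  have hZ : Measurable Z := (measurable_completionTime fun k _ => hm _ _).prodMk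
    (measurable_agesAfter x₀ fun k _ => hm _ _)
  have hD : Measurable D := hm _ _
  have hDlaw : P.map D = expMeasure (rate q) := (hS.hasLaw q (n / 2)).map_eq
  have := isProbabilityMeasure_expMeasure (hr q)
  have hK₁ : Measurable fun (p : (ℝ × (Fin 3 → ℝ)) × ℝ) (j : Fin 3) =>
      p.1.2 j + (t - p.1.1) := by fun_prop
  have hK₂ : Measurable fun (p : (ℝ × (Fin 3 → ℝ)) × ℝ) (j : Fin 3) => p.1.2 j + p.2 := by
    fun_prop
  have hK : Measurable K := by
    refine Measurable.ite (measurableSet_le (by fun_prop) measurable_const)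
      (Measurable.ite (measurableSet_lt (by fun_prop) (by fun_prop))
        ((hh.continuous_initial q).measurable.comp hK₁)
        ((hh.continuous (next q)).measurable.comp (Measurable.prodMk (by fun_prop)
          ((continuous_reset q).measurable.comp hK₂)))) measurable_const
  have hKeq : (fun ω => K (Z ω, D ω)) =ᵐ[P] fun ω =>
      currentValue f (fun i k => S i k ω) q₀ x₀ t n +
        pendingValue h (fun i k => S i k ω) q₀ x₀ t (n + 1) := by
    filter_upwards [hS.ae_isRegular hr hm q₀] with ω hω
    have hpos := hω.pos n
    simp only [K, Z, D, currentValue, pendingValue, completionTime_succ, stateAfter_succ, agesAfter,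
      ← hq, sub_lt_iff_lt_add', sub_sub]
    by_cases h1 : completionTime (fun i k => S i k ω) q₀ n ≤ t
    · by_cases h2 : t < completionTime (fun i k => S i k ω) q₀ n +
        duration (fun i k => S i k ω) q₀ n
      · simp [h1, h2]
      · simp [h1, h2, not_lt.1 h2]
    -- A positive duration keeps the next completion beyond `t` too.
    · have h2 : ¬ completionTime (fun i k => S i k ω) q₀ n +
        duration (fun i k => S i k ω) q₀ n ≤ t := fun h' => h1 (by linarith)
      simp [h1, h2]
  have hmap : P.map (fun ω => (Z ω, D ω)) = (P.map Z).prod (expMeasure (rate q)) := by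
    rw [← hDlaw]
    exact (indepFun_iff_map_prod_eq_prod_map_map hZ.aemeasurable hD.aemeasurable).1
      (hS.indepFun_completion hm q₀ x₀ n)
  have hprob : IsProbabilityMeasure (P.map Z) := Measure.isProbabilityMeasure_map hZ.aemeasurable
  have hKi : Integrable K ((P.map Z).prod (expMeasure (rate q))) := by
    rw [← hmap, integrable_map_measure hK.aestronglyMeasurable (hZ.prodMk hD).aemeasurable]
    exact hi.congr hKeq.symm
  have hinner : ∀ z : ℝ × (Fin 3 → ℝ), ∫ u, K (z, u) ∂expMeasure (rate q) =
      if z.1 ≤ t then h (t - z.1) q z.2 else 0 := fun z => by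
    by_cases hz : z.1 ≤ t
    · simp only [K, hz, if_true]
      exact hh.integral_first_completion hr (sub_nonneg.2 hz) q z.2
    · simp [K, hz]
  rw [← integral_congr_ae hKeq, ← integral_map (f := K) (hZ.prodMk hD).aemeasurable
    hK.aestronglyMeasurable, hmap, integral_prod K hKi]
  simp only [hinner]
  rw [integral_map hZ.aemeasurable]
  · rfl
  · exact (Measurable.ite (measurableSet_le measurable_fst measurable_const)
      ((hh.continuous q).measurable.comp
        ((measurable_const.sub measurable_fst).prodMk measurable_snd)) measurable_const).aestronglyMeasurable

/-- A solution of the backward equation gives the expectation of `f` at time `t`. -/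
theorem IsBackwardSolution.integral_eq [IsProbabilityMeasure P]
    (hh : IsBackwardSolution rate f h)
    (hr : ∀ q, 0 < rate q) (hS : IsServiceTimes P rate S) (hm : ∀ i k, Measurable (S i k))
    (q₀ : Fin 2) (x₀ : Fin 3 → ℝ) {t : ℝ} (ht : 0 ≤ t) :
    Integrable (fun ω => f (stateAt (fun i k => S i k ω) q₀ t)
      (agesAt (fun i k => S i k ω) q₀ x₀ t)) P ∧
    ∫ ω, f (stateAt (fun i k => S i k ω) q₀ t) (agesAt (fun i k => S i k ω) q₀ x₀ t) ∂P =
      h t q₀ x₀ := by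
  obtain ⟨C, hC, hx⟩ : ∃ C, 0 ≤ C ∧ ∀ j, |x₀ j| ≤ C :=
    ⟨‖x₀‖, norm_nonneg _, fun j => norm_le_pi_norm x₀ j⟩
  obtain ⟨B, hB⟩ := hh.exists_bound t (C + t)
  have hB₀ : 0 ≤ B := (abs_nonneg _).trans
    (hB 0 0 (fun _ => 0) le_rfl ht fun j => by simpa using add_nonneg hC ht)
  have hreg := hS.ae_isRegular hr hm q₀
  have hval : ∀ᵐ ω ∂P, |f (stateAt (fun i k => S i k ω) q₀ t)
      (agesAt (fun i k => S i k ω) q₀ x₀ t)| ≤ B := by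
    filter_upwards [hreg] with ω hω
    rw [← hh.initial]
    exact hB _ _ _ le_rfl ht (hω.abs_agesAt_le ht hC hx)
  have hcm := fun n => (hh.measurable_currentValue hm q₀ x₀ t n).aestronglyMeasurable (μ := P)
  have hpm := fun n => (hh.measurable_pendingValue hm q₀ x₀ t n).aestronglyMeasurable (μ := P)
  have hcb : ∀ n, ∀ᵐ ω ∂P, ‖currentValue f (fun i k => S i k ω) q₀ x₀ t n‖ ≤ B := fun n => by
    filter_upwards [hreg, hval] with ω hω hv
    rw [hω.currentValue_eq ht]
    split_ifs <;> simp [hv, hB₀]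
  have hpb : ∀ n, ∀ᵐ ω ∂P, ‖pendingValue h (fun i k => S i k ω) q₀ x₀ t n‖ ≤ B := fun n => by
    filter_upwards [hreg] with ω hω
    exact hω.abs_pendingValue_le hB₀ hC hx hB
  have hci := fun n => Integrable.of_bound (hcm n) B (hcb n)
  have hpi := fun n => Integrable.of_bound (hpm n) B (hpb n)
  let F : ℕ → Ω → ℝ := fun n ω =>
    ∑ k ∈ Finset.range n, currentValue f (fun i k => S i k ω) q₀ x₀ t k
  have hFi : ∀ n, Integrable (F n) P := fun n => integrable_finsetSum _ fun k _ => hci k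
  -- An invariant in `n`: each step exchanges one pending value for a current value and the next
  -- pending value.
  have hsum : ∀ n, ∫ ω, F n ω ∂P + ∫ ω, pendingValue h (fun i k => S i k ω) q₀ x₀ t n ∂P =
      h t q₀ x₀ := fun n => by
    induction n with
    | zero => simp [F, pendingValue, completionTime, ht, agesAfter, stateAfter]
    | succ n ih =>
      rw [← ih, hh.integral_pendingValue hr hS hm q₀ x₀ t n ((hci n).add (hpi (n + 1))),
        integral_add (hci n) (hpi (n + 1)), ← add_assoc, ← integral_add (hFi n) (hci n)]
      simp only [F, Finset.sum_range_succ]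
  have hFlim : ∀ᵐ ω ∂P, Tendsto (fun n => F n ω) atTop
      (𝓝 (f (stateAt (fun i k => S i k ω) q₀ t) (agesAt (fun i k => S i k ω) q₀ x₀ t))) := by
    filter_upwards [hreg] with ω hω
    refine tendsto_const_nhds.congr' ?_
    filter_upwards [eventually_gt_atTop (numCompletions (fun i k => S i k ω) q₀ t)] with n hn
    simp only [F, hω.sum_currentValue_eq ht, if_pos hn]
  have hFb : ∀ n, ∀ᵐ ω ∂P, ‖F n ω‖ ≤ B := fun n => by
    filter_upwards [hreg, hval] with ω hω hv
    simp only [F, hω.sum_currentValue_eq ht]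
    split_ifs <;> simp [hv, hB₀]
  have hplim : ∀ᵐ ω ∂P, Tendsto
      (fun n => pendingValue h (fun i k => S i k ω) q₀ x₀ t n) atTop (𝓝 0) := by
    filter_upwards [hreg] with ω hω
    refine tendsto_const_nhds.congr' ?_
    filter_upwards [eventually_gt_atTop (numCompletions (fun i k => S i k ω) q₀ t)] with n hn
    rw [pendingValue, if_neg (mt (hω.le_iff_le_numCompletions ht n).1 (not_le.2 hn))]
  have hlim1 := tendsto_integral_of_dominated_convergence (fun _ => B)
    (fun n => (hFi n).aestronglyMeasurable) (integrable_const B) hFb hFlim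
  have hlim2 := tendsto_integral_of_dominated_convergence (fun _ => B) hpm
    (integrable_const B) hpb hplim
  -- Measurability comes from the almost sure limit of `F n`, so `numCompletions` is never shown
  -- measurable.
  refine ⟨Integrable.of_bound (aestronglyMeasurable_of_tendsto_ae atTop
    (fun n => (hFi n).aestronglyMeasurable) hFlim) B hval, ?_⟩
  have := hlim1.add hlim2
  simp only [hsum, integral_zero, add_zero] at this
  exact tendsto_nhds_unique this tendsto_const_nhds

/-- The laws give only a.e. measurability. As there are countably many service times, measurable
versions reproduce almost every whole path. -/
theorem IsServiceTimes.exists_measurable (hS : IsServiceTimes P rate S) :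
    ∃ S' : Fin 2 → ℕ → Ω → ℝ, (∀ i k, Measurable (S' i k)) ∧ IsServiceTimes P rate S' ∧
      ∀ᵐ ω ∂P, (fun i k => S i k ω) = fun i k => S' i k ω := by
  have hae := fun i k => (hS.hasLaw i k).aemeasurable
  refine ⟨fun i k => (hae i k).mk, fun i k => (hae i k).measurable_mk,
    ⟨fun i k => (hS.hasLaw i k).congr (hae i k).ae_eq_mk.symm,
      hS.indep.congr fun ik => (hae ik.1 ik.2).ae_eq_mk⟩, ?_⟩
  have h1 : ∀ᵐ ω ∂P, ∀ i k, S i k ω = (hae i k).mk (S i k) ω :=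
    ae_all_iff.2 fun i => ae_all_iff.2 fun k => (hae i k).ae_eq_mk
  filter_upwards [h1] with ω hω
  funext i k
  exact hω i k

theorem isStationary_generator_iff (hr : ∀ q, 0 < rate q) (π : Fin 2 → ℝ) :
    IsStationary (generator rate) π ↔ π = fun q => rate (next q) / (rate 0 + rate 1) := by
  have h0 := hr 0
  have h1 := hr 1
  have hR : rate 0 + rate 1 ≠ 0 := (add_pos h0 h1).ne'
  -- Both coordinates express the same balance of flows between the two states.
  have hv : Matrix.vecMul π (generator rate) = 0 ↔ π 0 * rate 0 = π 1 * rate 1 := by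
    simp only [funext_iff, Fin.forall_fin_two, Matrix.vecMul, dotProduct, Fin.sum_univ_two,
      generator, next, Pi.zero_apply]
    simp
    constructor
    · rintro ⟨ha, -⟩
      linarith
    · intro ha
      constructor <;> linarith
  rw [IsStationary, hv, Fin.sum_univ_two, funext_iff, Fin.forall_fin_two, Fin.forall_fin_two]
  simp only [next, if_true, one_ne_zero, if_false]
  constructor
  · rintro ⟨-, ha, hb⟩
    constructor
    · rw [eq_div_iff hR]
      linear_combination hb + rate 1 * ha
    · rw [eq_div_iff hR]
      linear_combination -hb + rate 0 * ha
  · rintro ⟨ha, hb⟩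
    rw [ha, hb]
    refine ⟨⟨by positivity, by positivity⟩, ?_, ?_⟩ <;> field_simp
    ring

end Expectation

end SSS

/-! ### Assembly of the result. -/

theorem mainTheorem5 {Ω : Type*} [MeasurableSpace Ω] (P : Measure Ω) [IsProbabilityMeasure P]
    (μ₁ μ₂ ρ α : ℝ) (hμ₁ : 0 < μ₁) (hμ₂ : 0 < μ₂) (hρ : ρ = μ₁ / μ₂)
    (S : Fin 2 → ℕ → Ω → ℝ) (hS : SSS.IsServiceTimes P ![μ₁, μ₂] S)
    (q₀ : Fin 2) (x₀ : Fin 3 → ℝ) :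
    (∀ t : ℝ, 0 ≤ t →
      Integrable (fun ω => SSS.monitorAge (fun i k => S i k ω) q₀ x₀ t) P) ∧
    Tendsto (fun t : ℝ => ∫ ω, SSS.monitorAge (fun i k => S i k ω) q₀ x₀ t ∂P) atTop
      (𝓝 (1 / μ₂ * (2 + 1 / ρ + 1 / (ρ * (1 + ρ))))) ∧
    ∃ π : Fin 2 → ℝ,
      (∀ π' : Fin 2 → ℝ, SSS.IsStationary (SSS.generator ![μ₁, μ₂]) π' ↔ π' = π) ∧
      (∀ q : Fin 2, Tendsto
        (fun t : ℝ => P.real {ω | SSS.stateAt (fun i k => S i k ω) q₀ t = q}) atTop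
        (𝓝 (π q))) ∧
      SSS.powerWeightedActivity π ρ α = (ρ ^ α + ρ) / (1 + ρ) := by
  have hr : ∀ q, 0 < (![μ₁, μ₂] : Fin 2 → ℝ) q := by
    simp [Fin.forall_fin_two, hμ₁, hμ₂]
  obtain ⟨S', hm, hS', hSS'⟩ := hS.exists_measurable
  have hage : ∀ t, (fun ω => SSS.monitorAge (fun i k => S' i k ω) q₀ x₀ t) =ᵐ[P]
      fun ω => SSS.monitorAge (fun i k => S i k ω) q₀ x₀ t := fun t => by
    filter_upwards [hSS'] with ω hω
    rw [hω]
  obtain ⟨h, hh, hlim⟩ := SSS.exists_backwardSolution_age hr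
  refine ⟨fun t ht => (hh.integral_eq hr hS' hm q₀ x₀ ht).1.congr (hage t), ?_,
    fun q => ![μ₁, μ₂] (SSS.next q) / (![μ₁, μ₂] 0 + ![μ₁, μ₂] 1),
    SSS.isStationary_generator_iff hr, fun q => ?_, ?_⟩
  · have hval : 1 / μ₂ * (2 + 1 / ρ + 1 / (ρ * (1 + ρ))) =
        (2 * μ₂ * (1 / μ₁ + 1 / μ₂) + μ₁ * (1 / μ₁ + 2 / μ₂)) / (μ₁ + μ₂) := by
      subst hρ
      field_simp
      ring
    rw [hval]
    refine (hlim q₀ x₀).congr' ?_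
    filter_upwards [eventually_ge_atTop 0] with t ht
    rw [← (hh.integral_eq hr hS' hm q₀ x₀ ht).2]
    exact integral_congr_ae (hage t)
  · obtain ⟨h', hh', hlim'⟩ := SSS.exists_backwardSolution_state hr q
    refine (hlim' q₀ x₀).congr' ?_
    filter_upwards [eventually_ge_atTop 0] with t ht
    obtain ⟨hint, heq⟩ := hh'.integral_eq hr hS' hm q₀ x₀ ht
    have hind : (fun ω => if SSS.stateAt (fun i k => S' i k ω) q₀ t = q then (1 : ℝ) else 0) =
        {ω | SSS.stateAt (fun i k => S' i k ω) q₀ t = q}.indicator fun _ => 1 := by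
      funext ω
      simp [Set.indicator]
    rw [hind] at hint heq
    -- Null-measurability of the event is recovered from integrability of its indicator.
    have hnull := (aemeasurable_indicator_const_iff (1 : ℝ)).1 hint.aemeasurable
    rw [integral_indicator₀ hnull, setIntegral_const, smul_eq_mul, mul_one] at heq
    rw [← heq]
    refine measureReal_congr ?_
    filter_upwards [hSS'] with ω hω
    refine propext ?_
    change SSS.stateAt (fun i k => S' i k ω) q₀ t = q ↔ SSS.stateAt (fun i k => S i k ω) q₀ t = q
    rw [hω]
  · have hn : ∀ q i : Fin 2, SSS.numWorking q i = if q = i then 1 else 0 := by decide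
    have h1 : 0 < ρ := hρ ▸ div_pos hμ₁ hμ₂
    simp only [SSS.powerWeightedActivity, SSS.meanWorking, hn, Fin.sum_univ_two, SSS.next]
    simp
    have h2 : μ₁ = ρ * μ₂ := by rw [hρ]; field_simp
    rw [h2]
    field_simp
    ring
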